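/- All graphs are finite and simple. For an edge $e=uv$ of a graph $G=(V,E)$ let $E[e]$ be the set of all edges incident with $u$ or $v$ (including $e$), and let $E(e)=E[e]\setminus\{e\}$. An edge colouring $c:E\to C$ is closed conflict-free if for every $e\in E$ some colour is assigned to exactly one element of $E[e]$, and open conflict-free if for every $e\in E$ with $E(e)\neq\emptyset$ some colour is assigned to exactly one element of $E(e)$. Let $\chi'_{\rm ccf}(G)$ and $\chi'_{\rm ocf}(G)$ denote the least number of colours in a closed, respectively open, conflict-free edge colouring of $G$. There is a function $\varepsilon:\mathbb{N}\to\mathbb{R}$ with $\varepsilon(\Delta)\to 0$ as $\Delta\to\infty$ such that: (i) for every graph $G$ with maximum degree $\Delta>1$, $$\chi'_{\rm ccf}(G)\leq (1+\varepsilon(\Delta))\log_2\Delta\quad\text{and}\quad \chi'_{\rm ocf}(G)\leq (1+\varepsilon(\Delta))\log_2\Delta;$$ (ii) these bounds are asymptotically tight, including the leading constant: for every $n\geq 3$, the complete graph $K_n$, whose maximum degree is $\Delta=n-1$, satisfies $$\chi'_{\rm ccf}(K_n)\geq (1-\varepsilon(\Delta))\log_2\Delta\quad\text{and}\quad \chi'_{\rm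 ocf}(K_n)\geq (1-\varepsilon(\Delta))\log_2\Delta.$$ -/

import Mathlib

namespace ConflictFree

variable {V C : Type*} {G : SimpleGraph V}

/-- The closed neighbourhood `E[e] = E(u) ∪ E(v)` of an edge `e = uv`: all edges of `G` that share
an endpoint with `e` (in particular `e` itself). -/
def closedNbhd (e : G.edgeSet) : Set G.edgeSet :=
  {f | ∃ v : V, v ∈ (e : Sym2 V) ∧ v ∈ (f : Sym2 V)}

/-- The open neighbourhood `E(e) = (E(u) ∪ E(v)) \ {e}` of an edge `e = uv`. -/
def openNbhd (e : G.edgeSet) : Set G.edgeSet :=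
  closedNbhd e \ {e}

/-- Some colour is assigned by `c` to exactly one element of the set `S` of edges. -/
def HasUniqueColour (c : G.edgeSet → C) (S : Set G.edgeSet) : Prop :=
  ∃ α : C, ∃! f : G.edgeSet, f ∈ S ∧ c f = α

/-- `c` is a closed conflict-free edge colouring of `G`. -/
def IsClosedConflictFree (c : G.edgeSet → C) : Prop :=
  ∀ e : G.edgeSet, HasUniqueColour c (closedNbhd e)

/-- `c` is an open conflict-free edge colouring of `G`. -/
def IsOpenConflictFree (c : G.edgeSet → C) : Prop :=
  ∀ e : G.edgeSet, (openNbhd e).Nonempty → HasUniqueColour c (openNbhd e)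

/-- The closed conflict-free chromatic index of `G`: the least number of colours in a closed
conflict-free edge colouring (which exists for finite `G`, see `closed_exists`). -/
noncomputable def closedIndex (G : SimpleGraph V) : ℕ :=
  sInf {k : ℕ | ∃ c : G.edgeSet → Fin k, IsClosedConflictFree c}

/-- The open conflict-free chromatic index of `G`: the least number of colours in an open
conflict-free edge colouring (which exists for finite `G`, see `open_exists`). -/
noncomputable def openIndex (G : SimpleGraph V) : ℕ :=
  sInf {k : ℕ | ∃ c : G.edgeSet → Fin k, IsOpenConflictFree c}

theorem mem_closedNbhd_self (e : G.edgeSet) : e ∈ closedNbhd e :=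
  ⟨(e : Sym2 V).out.1, Sym2.out_fst_mem _, Sym2.out_fst_mem _⟩

theorem hasUniqueColour_of_injective {c : G.edgeSet → C} (hc : Function.Injective c)
    {S : Set G.edgeSet} (hS : S.Nonempty) : HasUniqueColour c S := by
  obtain ⟨e, he⟩ := hS
  exact ⟨c e, e, ⟨he, rfl⟩, fun f hf => hc hf.2⟩

/-- The set defining `closedIndex` is nonempty for finite graphs. -/
theorem closed_exists [Finite V] (G : SimpleGraph V) :
    {k : ℕ | ∃ c : G.edgeSet → Fin k, IsClosedConflictFree c}.Nonempty :=
  ⟨Nat.card G.edgeSet, Finite.equivFin G.edgeSet, fun e =>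
    hasUniqueColour_of_injective (Finite.equivFin G.edgeSet).injective
      ⟨e, mem_closedNbhd_self e⟩⟩

/-- The set defining `openIndex` is nonempty for finite graphs. -/
theorem open_exists [Finite V] (G : SimpleGraph V) :
    {k : ℕ | ∃ c : G.edgeSet → Fin k, IsOpenConflictFree c}.Nonempty :=
  ⟨Nat.card G.edgeSet, Finite.equivFin G.edgeSet, fun _ he =>
    hasUniqueColour_of_injective (Finite.equivFin G.edgeSet).injective he⟩

end ConflictFree

/-!
Upper bound. The edges are partitioned as `P ∪ Q ∪ F ∪ T`. Here `P` is a maximal set of edges with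
degrees at most `s`, where `s` is of order `log log Δ`, and `F` is the domain of a maximal partial
proper colouring of the edges outside `P ∪ Q` with `k = (1 + o(1)) log₂ Δ` colours. By maximality
every edge of `T` sees all `k` colours on `F`. Keep each edge of `F` in its colour with probability
`1 / 2` and give it a default colour otherwise. For every edge `uv` of `T` the sets of kept colours
at `u` and at `v` agree with probability at most `2 ^ (-k)`, and if they differ then some colour
occurs exactly once at one end and not at all at the other. A counting argument in the style of
Rosenfeld (`exists_avoiding`), playing the part of the local lemma, makes all these sets differ at
once (`exists_split`).

The edges of `F` form a graph of degree at most `k` only. Every such edge has an end of degree `s`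
in `P`, so that the same lemma, applied to a colouring of `P` that is rainbow in the neighbourhood of
each edge of `P`, deals with them; now `O(s²) = o(log Δ)` colours suffice, and a fair coin chooses
between two copies of the palette, so that the edges of `P` keep their rainbow neighbourhoods. The
only trouble is the open neighbourhood of an edge isolated in `P`: one adjacent edge is put into
`Q` and gets one further colour. By maximality of `P` this edge joins a vertex of `P`-degree `1` to
one of `P`-degree `s ≥ 2`, whence it is conflict-free and serves one isolated edge only. All this is
`exists_conflictFree`.

Lower bound. In a conflict-free colouring of `K_n` with `k` colours, assign to each vertex the set of
colours that occur on exactly one of its edges. If two vertices `u`, `v` get the same set, the unique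
colour of the neighbourhood of `uv` must be the colour of `uv`, and `uv` is the only edge of this
colour at `u` or at `v`. As a vertex has at most `k` such edges, at most `2 k + 1` vertices get the
same set, and `n ≤ 2 ^ k (2 k + 1)` (`le_of_isSoleAt_or`).
-/

namespace ConflictFree

/-! ### Avoiding events by counting -/

section Counting

variable {X I : Type*} [DecidableEq X]

open Classical in
/-- The subsets `K` of `S` that avoid every event of `T` whose support lies inside `S`. -/
noncomputable def avoiding (T : Finset I) (supp : I → Finset X) (bad : I → Finset X → Prop)
    (S : Finset X) : Finset (Finset X) :=
  {K ∈ S.powerset | ∀ i ∈ T, supp i ⊆ S → ¬ bad i (K ∩ supp i)}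

theorem mem_avoiding {T : Finset I} {supp : I → Finset X} {bad : I → Finset X → Prop}
    {S K : Finset X} : K ∈ avoiding T supp bad S ↔
      K ⊆ S ∧ ∀ i ∈ T, supp i ⊆ S → ¬ bad i (K ∩ supp i) := by
  simp [avoiding]

/-- The inductive step of the counting argument. Among the `2 |N(S)|` extensions of the members of
`N(S)` to `insert x S`, where `N(S)` is the set of subsets avoiding the events inside `S`, those in
which the event `i` happens are determined by their trace outside `R`, which avoids the events
inside `insert x S \ R`; by the induction hypothesis there are at most `|N(S)| / β ^ (q - 1)` of
them. -/
theorem card_avoiding_insert {T : Finset I} {supp : I → Finset X} {bad : I → Finset X → Prop}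
    {β : ℝ} (hβ : 1 ≤ β) {d q : ℕ} (hdq : d ≤ (2 - β) * β ^ (q - 1))
    (hdet : ∀ i ∈ T, ∀ x ∈ supp i, ∃ R ⊆ supp i, x ∈ R ∧ q ≤ R.card ∧
      ∀ K ⊆ supp i, ∀ K' ⊆ supp i, bad i K → bad i K' → K \ R = K' \ R → K = K')
    (hdeg : ∀ x, Set.ncard {i | i ∈ T ∧ x ∈ supp i} ≤ d) {S : Finset X} {x : X} (hx : x ∉ S)
    (ih : ∀ A ⊆ S, β ^ (S.card - A.card) * (avoiding T supp bad A).card ≤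
      (avoiding T supp bad S).card) :
    β * (avoiding T supp bad S).card ≤ (avoiding T supp bad (insert x S)).card := by
  classical
  set N := avoiding T supp bad with hN
  set Tx : Finset I := {i ∈ T | x ∈ supp i ∧ supp i ⊆ insert x S} with hTx
  have hTxd : Tx.card ≤ d := by
    refine le_trans ?_ (hdeg x)
    rw [← Set.ncard_coe_finset]
    refine Set.ncard_le_ncard ?_ (T.finite_toSet.subset fun i hi => hi.1)
    intro i hi
    simp only [hTx, Finset.coe_filter, Set.mem_ofPred_eq] at hi
    exact ⟨hi.1, hi.2.1⟩
  -- the two extensions of every member of `N S`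
  set A : Finset (Finset X) := N S ∪ (N S).image (insert x) with hA
  have hxK : ∀ K ∈ N S, x ∉ K := fun K hK hxK => hx ((mem_avoiding.1 hK).1 hxK)
  have hAcard : A.card = 2 * (N S).card := by
    rw [hA, Finset.card_union_of_disjoint, Finset.card_image_of_injOn, two_mul]
    · intro K hK K' hK' h
      have h' : (insert x K).erase x = (insert x K').erase x := congrArg (Finset.erase · x) h
      rwa [Finset.erase_insert (hxK K hK), Finset.erase_insert (hxK K' hK')] at h'
    · rw [Finset.disjoint_left]
      intro K hK hK'
      obtain ⟨K', _, rfl⟩ := Finset.mem_image.1 hK'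
      exact hxK _ hK (Finset.mem_insert_self _ _)
  have hAerase : ∀ K ∈ A, K ⊆ insert x S ∧ K.erase x ∈ N S := by
    intro K hK
    rcases Finset.mem_union.1 hK with hK | hK
    · exact ⟨(mem_avoiding.1 hK).1.trans (Finset.subset_insert _ _),
        by rwa [Finset.erase_eq_of_notMem (hxK K hK)]⟩
    · obtain ⟨K', hK', rfl⟩ := Finset.mem_image.1 hK
      exact ⟨Finset.insert_subset_insert _ (mem_avoiding.1 hK').1,
        by rwa [Finset.erase_insert (hxK K' hK')]⟩
  have hcover : A ⊆ N (insert x S) ∪ Tx.biUnion fun i => {K ∈ A | bad i (K ∩ supp i)} := by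
    intro K hK
    by_cases hKN : K ∈ N (insert x S)
    · exact Finset.mem_union_left _ hKN
    refine Finset.mem_union_right _ ?_
    rw [hN, mem_avoiding] at hKN
    push Not at hKN
    obtain ⟨i, hi, hiS, hbad⟩ := hKN (hAerase K hK).1
    refine Finset.mem_biUnion.2 ⟨i, ?_, Finset.mem_filter.2 ⟨hK, hbad⟩⟩
    refine Finset.mem_filter.2 ⟨hi, ?_, hiS⟩
    by_contra hxi
    have hsub : supp i ⊆ S := fun y hy =>
      (Finset.mem_insert.1 (hiS hy)).resolve_left fun h => hxi (h ▸ hy)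
    refine (mem_avoiding.1 (hAerase K hK).2).2 i hi hsub ?_
    convert hbad using 1
    ext y
    simp only [Finset.mem_inter, Finset.mem_erase]
    constructor
    · exact fun h => ⟨h.1.2, h.2⟩
    · exact fun h => ⟨⟨fun hyx => hxi (hyx ▸ h.2), h.1⟩, h.2⟩
  have hB : ∀ i ∈ Tx, β ^ (q - 1) * (({K ∈ A | bad i (K ∩ supp i)} : Finset _).card : ℝ) ≤
      (N S).card := by
    intro i hi
    obtain ⟨hiT, hxi, hiS⟩ := Finset.mem_filter.1 hi
    obtain ⟨R, hRs, hxR, hqR, hR⟩ := hdet i hiT x hxi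
    have hsub : insert x S \ R ⊆ S := by
      intro y hy
      obtain ⟨hy, hyR⟩ := Finset.mem_sdiff.1 hy
      exact (Finset.mem_insert.1 hy).resolve_left fun h => hyR (h ▸ hxR)
    have hcard : ({K ∈ A | bad i (K ∩ supp i)} : Finset _).card ≤ (N (insert x S \ R)).card := by
      refine Finset.card_le_card_of_injOn (fun K => K \ R) ?_ ?_
      · intro K hK
        obtain ⟨hKA, -⟩ := Finset.mem_filter.1 hK
        refine mem_avoiding.2 ⟨Finset.sdiff_subset_sdiff (hAerase K hKA).1 (le_refl _), ?_⟩
        intro j hj hjS hbad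
        refine (mem_avoiding.1 (hAerase K hKA).2).2 j hj (hjS.trans hsub) ?_
        convert hbad using 1
        ext y
        simp only [Finset.mem_inter, Finset.mem_erase, Finset.mem_sdiff]
        constructor
        · exact fun h => ⟨⟨h.1.2, (Finset.mem_sdiff.1 (hjS h.2)).2⟩, h.2⟩
        · exact fun h => ⟨⟨fun hyx => h.1.2 (hyx ▸ hxR), h.1.1⟩, h.2⟩
      · intro K hK K' hK' h
        obtain ⟨-, hb⟩ := Finset.mem_filter.1 hK
        obtain ⟨-, hb'⟩ := Finset.mem_filter.1 hK'
        have hd : ∀ y, y ∉ R → (y ∈ K ↔ y ∈ K') := by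
          intro y hy
          have := congrArg (fun Z => y ∈ Z) h
          simpa [hy] using this
        have := hR _ Finset.inter_subset_right _ Finset.inter_subset_right hb hb' (by
          ext y
          simp only [Finset.mem_sdiff, Finset.mem_inter]
          exact ⟨fun h => ⟨⟨(hd y h.2).1 h.1.1, h.1.2⟩, h.2⟩,
            fun h => ⟨⟨(hd y h.2).2 h.1.1, h.1.2⟩, h.2⟩⟩)
        ext y
        by_cases hy : y ∈ R
        · have := congrArg (fun Z => y ∈ Z) this
          simpa [hRs hy] using this
        · exact hd y hy
    have hSc : q - 1 ≤ S.card - (insert x S \ R).card := by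
      have h1 : (insert x S \ R).card = (insert x S).card - R.card :=
        Finset.card_sdiff_of_subset (hRs.trans hiS)
      have h2 := Finset.card_le_card (hRs.trans hiS)
      rw [Finset.card_insert_of_notMem hx] at h1 h2
      omega
    calc β ^ (q - 1) * (({K ∈ A | bad i (K ∩ supp i)} : Finset _).card : ℝ)
        ≤ β ^ (S.card - (insert x S \ R).card) * (N (insert x S \ R)).card := by
          gcongr
      _ ≤ _ := ih _ hsub
  have hsum : 2 * ((N S).card : ℝ) ≤ (N (insert x S)).card +
      ∑ i ∈ Tx, (({K ∈ A | bad i (K ∩ supp i)} : Finset _).card : ℝ) := by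
    have h := (Finset.card_le_card hcover).trans (Finset.card_union_le _ _)
    have h := h.trans (Nat.add_le_add_left Finset.card_biUnion_le _)
    rw [hAcard] at h
    exact_mod_cast h
  have hpos : 0 < β ^ (q - 1) := by positivity
  have hsum2 : ∑ i ∈ Tx, (({K ∈ A | bad i (K ∩ supp i)} : Finset _).card : ℝ) ≤
      (2 - β) * (N S).card := by
    have h1 : β ^ (q - 1) * ∑ i ∈ Tx, (({K ∈ A | bad i (K ∩ supp i)} : Finset _).card : ℝ) ≤
        d * (N S).card := by
      rw [Finset.mul_sum]
      refine (Finset.sum_le_card_nsmul _ _ _ hB).trans ?_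
      rw [nsmul_eq_mul]
      gcongr
    refine le_of_mul_le_mul_left (h1.trans ?_) hpos
    calc (d : ℝ) * (N S).card ≤ (2 - β) * β ^ (q - 1) * (N S).card := by gcongr
      _ = _ := by ring
  linarith

/-- Let each event `i ∈ T` depend on `K ∩ supp i` only, and let it determine the restriction of `K`
to some `R ∋ x` with at least `q` elements from the rest of `K`, for every `x ∈ supp i`. If every
`x` lies in the support of at most `d ≤ 2 ^ q / (4 q)` events, then some `K` avoids all events. This
takes the place of the Lovász local lemma: with `β = 2 - 1 / q`, each further element multiplies
the number of avoiding sets by at least `β`. -/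
theorem exists_avoiding [Fintype X] {T : Finset I} {supp : I → Finset X}
    {bad : I → Finset X → Prop} {d q : ℕ} (hq : 1 ≤ q) (hdq : 4 * d * q ≤ 2 ^ q)
    (hne : ∀ i ∈ T, (supp i).Nonempty)
    (hdet : ∀ i ∈ T, ∀ x ∈ supp i, ∃ R ⊆ supp i, x ∈ R ∧ q ≤ R.card ∧
      ∀ K ⊆ supp i, ∀ K' ⊆ supp i, bad i K → bad i K' → K \ R = K' \ R → K = K')
    (hdeg : ∀ x, Set.ncard {i | i ∈ T ∧ x ∈ supp i} ≤ d) :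
    ∃ K : Finset X, ∀ i ∈ T, ¬ bad i (K ∩ supp i) := by
  classical
  have hq' : (1 : ℝ) ≤ q := by exact_mod_cast hq
  have hqi : (q : ℝ)⁻¹ ≤ 1 := inv_le_one_of_one_le₀ hq'
  have hβ : 1 ≤ 2 - (q : ℝ)⁻¹ := by linarith
  have hdβ : (d : ℝ) ≤ (2 - (2 - (q : ℝ)⁻¹)) * (2 - (q : ℝ)⁻¹) ^ (q - 1) := by
    -- Bernoulli's inequality bounds `(1 - 1 / (2 q)) ^ (q - 1)` from below by `1 / 2`
    have hb : (1 / 2 : ℝ) ≤ (1 + -(1 / (2 * q))) ^ (q - 1) := by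
      refine le_trans ?_ (one_add_mul_le_pow (a := -(1 / (2 * q) : ℝ)) ?_ (q - 1))
      · rw [Nat.cast_sub hq]
        field_simp
        push_cast
        nlinarith
      · have : 1 / (2 * (q : ℝ)) ≤ 1 := by
          rw [div_le_one (by positivity)]; linarith
        linarith
    have he : (2 - (q : ℝ)⁻¹) ^ (q - 1) = 2 ^ (q - 1) * (1 + -(1 / (2 * q))) ^ (q - 1) := by
      rw [← mul_pow]; congr 1; field_simp; ring
    have h2 : (2 : ℝ) ^ q = 2 * 2 ^ (q - 1) := by
      rw [← pow_succ']; congr 1; omega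
    have h3 : (4 * d * q : ℝ) ≤ 2 ^ q := by exact_mod_cast hdq
    have h4 : (2 : ℝ) ^ (q - 1) * (1 / 2) ≤ (2 - (q : ℝ)⁻¹) ^ (q - 1) := by
      rw [he]; gcongr
    have h5 : (d : ℝ) * q ≤ (2 - (q : ℝ)⁻¹) ^ (q - 1) := by linarith
    have h6 : (2 - (2 - (q : ℝ)⁻¹)) = (q : ℝ)⁻¹ := by ring
    rw [h6, le_inv_mul_iff₀ (by positivity)]
    linarith
  set N := avoiding T supp bad with hN
  have key : ∀ n : ℕ, ∀ S : Finset X, S.card = n → ∀ A ⊆ S,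
      (2 - (q : ℝ)⁻¹) ^ (S.card - A.card) * (N A).card ≤ (N S).card := by
    intro n
    induction n with
    | zero =>
      intro S hS A hA
      obtain rfl := Finset.card_eq_zero.1 hS
      obtain rfl := Finset.subset_empty.1 hA
      simp
    | succ n ih =>
      intro S hS A hA
      rcases eq_or_ne A S with rfl | hne'
      · simp
      obtain ⟨x, hxS, hxA⟩ := Finset.exists_of_ssubset (hA.ssubset_of_ne hne')
      have hc : (S.erase x).card = n := by rw [Finset.card_erase_of_mem hxS]; omega
      have hA' : A ⊆ S.erase x := fun y hy =>
        Finset.mem_erase.2 ⟨fun h => hxA (h ▸ hy), hA hy⟩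
      have h1 := card_avoiding_insert hβ hdβ hdet hdeg (Finset.notMem_erase x S) (ih _ hc)
      rw [Finset.insert_erase hxS] at h1
      have h2 := ih _ hc A hA'
      have h3 := Finset.card_le_card hA'
      have h4 : S.card - A.card = ((S.erase x).card - A.card) + 1 := by omega
      rw [h4, pow_succ]
      calc _ = (2 - (q : ℝ)⁻¹) * ((2 - (q : ℝ)⁻¹) ^ ((S.erase x).card - A.card) * (N A).card) := by
            ring
        _ ≤ (2 - (q : ℝ)⁻¹) * (N (S.erase x)).card := by gcongr
        _ ≤ _ := h1
  have h0 : (N ∅).card = 1 := by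
    refine Finset.card_eq_one.2 ⟨∅, ?_⟩
    ext K
    rw [hN, mem_avoiding, Finset.mem_singleton, Finset.subset_empty]
    refine and_iff_left_of_imp fun _ i hi h => ?_
    exact absurd (Finset.subset_empty.1 h) (hne i hi).ne_empty
  have h1 := key _ Finset.univ rfl ∅ (Finset.empty_subset _)
  rw [h0] at h1
  have h2 : (0 : ℝ) < (N Finset.univ).card := by
    refine lt_of_lt_of_le ?_ h1
    positivity
  obtain ⟨K, hK⟩ := Finset.card_pos.1 (by exact_mod_cast h2)
  exact ⟨K, fun i hi => (mem_avoiding.1 hK).2 i hi (Finset.subset_univ _)⟩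

end Counting

/-! ### Splitting a properly coloured set of edges -/

section Split

variable {V κ : Type*} {G : SimpleGraph V}

open Classical in
/-- The edges of `P` incident with the vertex `v`. -/
noncomputable def star (P : Finset G.edgeSet) (v : V) : Finset G.edgeSet :=
  {e ∈ P | v ∈ (e : Sym2 V)}

theorem mem_star {P : Finset G.edgeSet} {v : V} {e : G.edgeSet} :
    e ∈ star P v ↔ e ∈ P ∧ v ∈ (e : Sym2 V) := by
  simp [star]

/-- The two ends of an edge. -/
theorem exists_ends (e : G.edgeSet) :
    ∃ u v : V, u ≠ v ∧ (∀ w, w ∈ (e : Sym2 V) ↔ w = u ∨ w = v) := by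
  obtain ⟨e, he⟩ := e
  induction e with
  | h u v => exact ⟨u, v, G.ne_of_adj he, fun w => by simp⟩

theorem edge_eq_of_mem {e f : G.edgeSet} {u v : V} (huv : u ≠ v) (hu : u ∈ (e : Sym2 V))
    (hv : v ∈ (e : Sym2 V)) (hu' : u ∈ (f : Sym2 V)) (hv' : v ∈ (f : Sym2 V)) : e = f :=
  Subtype.ext (((Sym2.mem_and_mem_iff huv).1 ⟨hu, hv⟩).trans
    ((Sym2.mem_and_mem_iff huv).1 ⟨hu', hv'⟩).symm)

theorem mem_closedNbhd_symm {e f : G.edgeSet} (h : f ∈ closedNbhd e) : e ∈ closedNbhd f := by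
  obtain ⟨v, h1, h2⟩ := h
  exact ⟨v, h2, h1⟩

/-- A set of edges of maximum degree at most `d` meets `E[e]` in at most `2 d` edges. -/
theorem ncard_closedNbhd_le {P : Finset G.edgeSet} {d : ℕ} (hP : ∀ v, (star P v).card ≤ d)
    (e : G.edgeSet) : Set.ncard {f | f ∈ P ∧ f ∈ closedNbhd e} ≤ 2 * d := by
  classical
  obtain ⟨u, v, -, huv⟩ := exists_ends e
  have hsub : {f | f ∈ P ∧ f ∈ closedNbhd e} ⊆ ((star P u ∪ star P v : Finset _) : Set _) := by
    rintro f ⟨hf, w, hw, hwf⟩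
    simp only [Finset.coe_union, Set.mem_union, Finset.mem_coe, mem_star]
    rcases (huv w).1 hw with rfl | rfl
    · exact Or.inl ⟨hf, hwf⟩
    · exact Or.inr ⟨hf, hwf⟩
  refine (Set.ncard_le_ncard hsub (Finset.finite_toSet _)).trans ?_
  rw [Set.ncard_coe_finset]
  have := Finset.card_union_le (star P u) (star P v)
  have := hP u
  have := hP v
  omega

open Classical in
/-- Every set `P` of properly coloured edges contains a subset `K` whose colour sets at the two
ends of `e` differ for every edge `e` of `T`, provided that each `e ∈ T` sees many colours of `P`.
For a uniformly random `K` the two colour sets agree with probability at most `2 ^ (-q)`: for every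
colour seen by `e`, one coin is forced by the others. -/
theorem exists_split [Fintype V] [DecidableEq κ] {P T : Finset G.edgeSet} {p : G.edgeSet → κ}
    (hp : ∀ v, Set.InjOn p (star P v)) (hPT : Disjoint P T) {D q : ℕ} (hq : 1 ≤ q)
    (hT : ∀ v, (star T v).card ≤ D) (hDq : 8 * D * q ≤ 2 ^ q)
    (hcov : ∀ e ∈ T, q ≤ (({f ∈ P | f ∈ closedNbhd e} : Finset _).image p).card) :
    ∃ K ⊆ P, ∀ e ∈ T, ∃ u ∈ (e : Sym2 V), ∃ v ∈ (e : Sym2 V), u ≠ v ∧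
      ∃ α, α ∈ (star K u).image p ∧ α ∉ (star K v).image p := by
  classical
  have hinter : ∀ (K : Finset G.edgeSet) (e : G.edgeSet), ∀ u ∈ (e : Sym2 V),
      star (K ∩ {f ∈ P | f ∈ closedNbhd e}) u = star (K ∩ P) u := by
    intro K e u hu
    ext f
    simp only [mem_star, Finset.mem_inter, Finset.mem_filter]
    exact ⟨fun h => ⟨⟨h.1.1, h.1.2.1⟩, h.2⟩, fun h => ⟨⟨h.1.1, h.1.2, u, hu, h.2⟩, h.2⟩⟩
  suffices hex : ∃ K : Finset G.edgeSet, ∀ e ∈ T, ¬ ∀ u ∈ (e : Sym2 V), ∀ v ∈ (e : Sym2 V),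
      (star (K ∩ {f ∈ P | f ∈ closedNbhd e}) u).image p =
        (star (K ∩ {f ∈ P | f ∈ closedNbhd e}) v).image p by
    obtain ⟨K, hK⟩ := hex
    refine ⟨K ∩ P, Finset.inter_subset_right, fun e he => ?_⟩
    have h := hK e he
    simp only [not_forall] at h
    obtain ⟨u, hu, v, hv, h⟩ := h
    rw [hinter K e u hu, hinter K e v hv] at h
    have huv : u ≠ v := fun huv => h (huv ▸ rfl)
    by_cases h' : (star (K ∩ P) u).image p ⊆ (star (K ∩ P) v).image p
    · obtain ⟨α, h1, h2⟩ := Finset.exists_of_ssubset (h'.ssubset_of_ne h)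
      exact ⟨v, hv, u, hu, huv.symm, α, h1, h2⟩
    · obtain ⟨α, h1, h2⟩ := Finset.not_subset.1 h'
      exact ⟨u, hu, v, hv, huv, α, h1, h2⟩
  refine exists_avoiding
    (supp := fun e => ({f ∈ P | f ∈ closedNbhd e} : Finset G.edgeSet))
    (bad := fun e K => ∀ u ∈ (e : Sym2 V), ∀ v ∈ (e : Sym2 V),
      (star K u).image p = (star K v).image p) (d := 2 * D) hq (by linarith) ?_ ?_ ?_
  · intro e he
    have := hq.trans (hcov e he)
    exact Finset.image_nonempty.1 (Finset.card_pos.1 this)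
  · intro e he x hx
    set s : Finset G.edgeSet := {f ∈ P | f ∈ closedNbhd e} with hs
    -- `R` consists of one edge of each colour seen by `e`, chosen so that `x ∈ R`
    have hsec : ∀ α, ∃ f, α ∈ s.image p → f ∈ s ∧ p f = α ∧ (α = p x → f = x) := by
      intro α
      by_cases hα : α ∈ s.image p
      · by_cases hαx : α = p x
        · exact ⟨x, fun _ => ⟨hx, hαx.symm, fun _ => rfl⟩⟩
        · obtain ⟨f, hf, hfα⟩ := Finset.mem_image.1 hα
          exact ⟨f, fun _ => ⟨hf, hfα, fun h => absurd h hαx⟩⟩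
      · exact ⟨x, fun h => absurd h hα⟩
    choose r hr using hsec
    refine ⟨(s.image p).image r, ?_, ?_, ?_, ?_⟩
    · intro f hf
      obtain ⟨α, hα, rfl⟩ := Finset.mem_image.1 hf
      exact (hr α hα).1
    · have hα := Finset.mem_image_of_mem p hx
      exact Finset.mem_image.2 ⟨p x, hα, (hr _ hα).2.2 rfl⟩
    · rw [Finset.card_image_of_injOn]
      · exact hcov e he
      · intro α hα β hβ h
        rw [← (hr α hα).2.1, ← (hr β hβ).2.1, h]
    · have hRinj : ∀ f ∈ (s.image p).image r, ∀ g ∈ (s.image p).image r, p f = p g → f = g := by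
        intro f hf g hg h
        obtain ⟨α, hα, rfl⟩ := Finset.mem_image.1 hf
        obtain ⟨β, hβ, rfl⟩ := Finset.mem_image.1 hg
        rw [(hr α hα).2.1, (hr β hβ).2.1] at h
        rw [h]
      have hRs : ∀ f ∈ (s.image p).image r, f ∈ s := by
        intro f hf
        obtain ⟨α, hα, rfl⟩ := Finset.mem_image.1 hf
        exact (hr α hα).1
      generalize (s.image p).image r = R at hRinj hRs
      have main : ∀ K ⊆ s, ∀ K' ⊆ s,
          (∀ u ∈ (e : Sym2 V), ∀ v ∈ (e : Sym2 V), (star K u).image p = (star K v).image p) →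
          (∀ u ∈ (e : Sym2 V), ∀ v ∈ (e : Sym2 V), (star K' u).image p = (star K' v).image p) →
          K \ R = K' \ R → K ⊆ K' := by
        intro K hKs K' hK's hb hb' h f hf
        by_cases hfR : f ∈ R
        swap
        · have : f ∈ K' \ R := h ▸ Finset.mem_sdiff.2 ⟨hf, hfR⟩
          exact (Finset.mem_sdiff.1 this).1
        obtain ⟨hfP, u, hu, huf⟩ := Finset.mem_filter.1 (hRs f hfR)
        obtain ⟨v, hv, hvu⟩ : ∃ v ∈ (e : Sym2 V), v ≠ u := by
          obtain ⟨a, b, hab, hab'⟩ := exists_ends e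
          rcases (hab' u).1 hu with rfl | rfl
          · exact ⟨b, (hab' b).2 (Or.inr rfl), hab.symm⟩
          · exact ⟨a, (hab' a).2 (Or.inl rfl), hab⟩
        have h1 : p f ∈ (star K v).image p :=
          hb u hu v hv ▸ Finset.mem_image_of_mem p (mem_star.2 ⟨hf, huf⟩)
        obtain ⟨g, hg, hgf⟩ := Finset.mem_image.1 h1
        obtain ⟨hgK, hvg⟩ := mem_star.1 hg
        have hgR : g ∉ R := by
          intro hgR
          obtain rfl := hRinj g hgR f hfR hgf
          obtain rfl := edge_eq_of_mem hvu hv hu hvg huf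
          exact Finset.disjoint_left.1 hPT hfP he
        have hgK' : g ∈ K' := by
          have : g ∈ K' \ R := h ▸ Finset.mem_sdiff.2 ⟨hgK, hgR⟩
          exact (Finset.mem_sdiff.1 this).1
        have h2 : p f ∈ (star K' u).image p :=
          hb' v hv u hu ▸ hgf ▸ Finset.mem_image_of_mem p (mem_star.2 ⟨hgK', hvg⟩)
        obtain ⟨f', hf', hff'⟩ := Finset.mem_image.1 h2
        obtain ⟨hf'K, huf'⟩ := mem_star.1 hf'
        have : f' = f := hp u (mem_star.2 ⟨(Finset.mem_filter.1 (hK's hf'K)).1, huf'⟩)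
          (mem_star.2 ⟨hfP, huf⟩) hff'
        exact this ▸ hf'K
      intro K hK K' hK' hb hb' h
      exact (main K hK K' hK' hb hb' h).antisymm (main K' hK' K hK hb' hb h.symm)
  · intro x
    refine le_trans (Set.ncard_le_ncard ?_ (Set.toFinite _)) (ncard_closedNbhd_le hT x)
    rintro e ⟨he, hx⟩
    exact ⟨he, mem_closedNbhd_symm (Finset.mem_filter.1 hx).2⟩

/-! ### Greedy and maximal structures -/

/-- Greedy colouring: if every element is in conflict with at most `n` others, `n + 1` colours
suffice. -/
theorem exists_greedy_colouring {X : Type*} [Finite X] (r : X → X → Prop)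
    (hr : ∀ x y, r x y → r y x) {n : ℕ} (hn : ∀ x, Set.ncard {y | r x y} ≤ n) :
    ∃ c : X → Fin (n + 1), ∀ x y, r x y → x ≠ y → c x ≠ c y := by
  classical
  have := Fintype.ofFinite X
  suffices h : ∀ S : Finset X, ∃ c : X → Fin (n + 1),
      ∀ x ∈ S, ∀ y ∈ S, r x y → x ≠ y → c x ≠ c y by
    obtain ⟨c, hc⟩ := h Finset.univ
    exact ⟨c, fun x y => hc x (Finset.mem_univ _) y (Finset.mem_univ _)⟩
  intro S
  induction S using Finset.induction_on with
  | empty => exact ⟨fun _ => 0, by simp⟩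
  | insert a S ha ih =>
    obtain ⟨c, hc⟩ := ih
    obtain ⟨γ, hγ⟩ : ∃ γ, γ ∉ c '' {y | r a y} := by
      by_contra! h
      have h1 : c '' {y | r a y} = Set.univ := Set.eq_univ_of_forall h
      have h2 := (Set.ncard_image_le (f := c) (Set.toFinite {y | r a y})).trans (hn a)
      rw [h1, Set.ncard_univ, Nat.card_eq_fintype_card, Fintype.card_fin] at h2
      omega
    have hγ' : ∀ y, r a y → γ ≠ c y := fun y hy h => hγ ⟨y, hy, h.symm⟩
    refine ⟨Function.update c a γ, ?_⟩
    intro x hx y hy hxy hne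
    rcases Finset.mem_insert.1 hx with rfl | hx
    · rw [Function.update_self, Function.update_of_ne hne.symm]
      exact hγ' y hxy
    · have hxa : x ≠ a := fun h => ha (h ▸ hx)
      rcases Finset.mem_insert.1 hy with rfl | hy
      · rw [Function.update_self, Function.update_of_ne hxa]
        exact (hγ' x (hr _ _ hxy)).symm
      · have hya : y ≠ a := fun h => ha (h ▸ hy)
        rw [Function.update_of_ne hxa, Function.update_of_ne hya]
        exact hc x hx y hy hxy hne

/-- A set `P` of edges of maximum degree at most `s` can be coloured with `4 s² + 1` colours so that
`E[e] ∩ P` is rainbow for each `e ∈ P`. -/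
theorem exists_strong_colouring [Finite V] {P : Finset G.edgeSet} {s : ℕ}
    (hP : ∀ v, (star P v).card ≤ s) :
    ∃ σ : G.edgeSet → Fin (4 * s ^ 2 + 1), ∀ e ∈ P, ∀ f ∈ P, ∀ g ∈ P,
      f ∈ closedNbhd e → g ∈ closedNbhd e → σ f = σ g → f = g := by
  classical
  have := Fintype.ofFinite V
  obtain ⟨σ, hσ⟩ := exists_greedy_colouring
    (fun f g : G.edgeSet => ∃ e ∈ P, g ∈ P ∧ f ∈ P ∧ f ∈ closedNbhd e ∧ g ∈ closedNbhd e)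
    (fun f g ⟨e, h1, h2, h3, h4, h5⟩ => ⟨e, h1, h3, h2, h5, h4⟩) (n := 4 * s ^ 2) (by
      intro f
      have hsub : {g | ∃ e ∈ P, g ∈ P ∧ f ∈ P ∧ f ∈ closedNbhd e ∧ g ∈ closedNbhd e} ⊆
          (({e ∈ P | e ∈ closedNbhd f} : Finset _).biUnion
            fun e => ({g ∈ P | g ∈ closedNbhd e} : Finset _) : Finset G.edgeSet) := by
        rintro g ⟨e, h1, h2, h3, h4, h5⟩
        refine Finset.mem_coe.2 (Finset.mem_biUnion.2 ⟨e, Finset.mem_filter.2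
          ⟨h1, mem_closedNbhd_symm h4⟩, Finset.mem_filter.2 ⟨h2, h5⟩⟩)
      have hc : ∀ e : G.edgeSet, ({g ∈ P | g ∈ closedNbhd e} : Finset _).card ≤ 2 * s := by
        intro e
        rw [← Set.ncard_coe_finset]
        simpa using ncard_closedNbhd_le hP e
      refine (Set.ncard_le_ncard hsub (Finset.finite_toSet _)).trans ?_
      rw [Set.ncard_coe_finset]
      refine (Finset.card_biUnion_le_card_mul _ _ _ fun e _ => hc e).trans ?_
      calc _ ≤ 2 * s * (2 * s) := Nat.mul_le_mul_right _ (hc f)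
        _ = _ := by ring)
  refine ⟨σ, fun e he f hf g hg h1 h2 h => ?_⟩
  by_contra hne
  exact hσ f g ⟨e, he, hg, hf, h1, h2⟩ hne h

/-- A maximal set `P` of edges with all degrees at most `s`: each edge outside `P` has an end of
degree exactly `s`. -/
theorem exists_maximal_bounded [Finite V] (G : SimpleGraph V) (s : ℕ) :
    ∃ P : Finset G.edgeSet, (∀ v, (star P v).card ≤ s) ∧
      ∀ e, e ∉ P → ∃ v ∈ (e : Sym2 V), (star P v).card = s := by
  classical
  have := Fintype.ofFinite V
  obtain ⟨P, hP, hmax⟩ := Finset.exists_max_image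
    ({P | ∀ v, (star P v).card ≤ s} : Finset (Finset G.edgeSet)) Finset.card
    ⟨∅, Finset.mem_filter.2 ⟨Finset.mem_univ _, fun v => by simp [star]⟩⟩
  simp only [Finset.mem_filter, Finset.mem_univ, true_and] at hP hmax
  refine ⟨P, hP, fun e he => ?_⟩
  by_contra! h
  have := hmax (insert e P) fun v => by
    have hstar : star (insert e P) v ⊆ insert e (star P v) := by
      intro f hf
      obtain ⟨hf, hv⟩ := mem_star.1 hf
      rcases Finset.mem_insert.1 hf with rfl | hf
      · exact Finset.mem_insert_self _ _
      · exact Finset.mem_insert_of_mem (mem_star.2 ⟨hf, hv⟩)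
    by_cases hv : v ∈ (e : Sym2 V)
    · have h1 := (Finset.card_le_card hstar).trans (Finset.card_insert_le _ _)
      have h2 := h v hv
      have h3 := hP v
      omega
    · refine le_trans (Finset.card_le_card ?_) (hP v)
      intro f hf
      refine (Finset.mem_insert.1 (hstar hf)).resolve_left ?_
      rintro rfl
      exact hv (mem_star.1 hf).2
  rw [Finset.card_insert_of_notMem he] at this
  omega

/-- A maximal partial proper colouring with `k` colours of the edges outside `X`; the value `none`
marks the uncoloured edges, and each of these outside `X` sees all `k` colours. -/
theorem exists_maximal_partial_colouring [Finite V] (X : Finset G.edgeSet) (k : ℕ) :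
    ∃ p : G.edgeSet → Option (Fin k), (∀ e ∈ X, p e = none) ∧
      (∀ e f, f ∈ closedNbhd e → p e = p f → p e ≠ none → e = f) ∧
      ∀ e, e ∉ X → p e = none → ∀ α : Fin k, ∃ f ∈ closedNbhd e, p f = some α := by
  classical
  have := Fintype.ofFinite V
  obtain ⟨p, hp, hmax⟩ := Finset.exists_max_image
    ({p | (∀ e ∈ X, p e = none) ∧ ∀ e f, f ∈ closedNbhd e → p e = p f → p e ≠ none → e = f} :
      Finset (G.edgeSet → Option (Fin k)))
    (fun p => ({e | p e ≠ none} : Finset G.edgeSet).card) ⟨fun _ => none, by simp⟩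
  simp only [Finset.mem_filter, Finset.mem_univ, true_and] at hp hmax
  refine ⟨p, hp.1, hp.2, fun e heX he α => ?_⟩
  by_contra! h
  have hlt := hmax (Function.update p e (some α)) ⟨?_, ?_⟩
  · refine absurd hlt (not_le.2 (Finset.card_lt_card ?_))
    refine (Finset.ssubset_iff_of_subset ?_).2 ⟨e, by simp, by simp [he]⟩
    intro f hf
    have hfe : f ≠ e := by rintro rfl; simp [he] at hf
    simpa [hfe] using hf
  · intro f hf
    have hfe : f ≠ e := by rintro rfl; exact heX hf
    rw [Function.update_of_ne hfe]
    exact hp.1 f hf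
  · intro f g hfg hpe hne
    rcases eq_or_ne f e with rfl | hfe
    · by_contra hgf
      rw [Function.update_self, Function.update_of_ne (Ne.symm hgf)] at hpe
      exact h g hfg hpe.symm
    · rw [Function.update_of_ne hfe] at hpe hne
      rcases eq_or_ne g e with rfl | hge
      · rw [Function.update_self] at hpe
        exact absurd hpe (h f (mem_closedNbhd_symm hfg))
      · rw [Function.update_of_ne hge] at hpe
        exact hp.2 f g hfg hpe hne

end Split

/-! ### The upper bound -/

section Upper

variable {V C : Type*} {G : SimpleGraph V}

theorem hasUniqueColour_of_closed {c : G.edgeSet → C} {e f : G.edgeSet} (hf : f ∈ closedNbhd e)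
    (hc : ∀ g ∈ closedNbhd e, c g = c f → g = f) : HasUniqueColour c (closedNbhd e) :=
  ⟨c f, f, ⟨hf, rfl⟩, fun g hg => hc g hg.1 hg.2⟩

theorem hasUniqueColour_of_open {c : G.edgeSet → C} {e f : G.edgeSet} (hf : f ∈ openNbhd e)
    (hc : ∀ g ∈ openNbhd e, c g = c f → g = f) : HasUniqueColour c (openNbhd e) :=
  ⟨c f, f, ⟨hf, rfl⟩, fun g hg => hc g hg.1 hg.2⟩

/-- If the colour of `f` occurs exactly once at one end `u` of `e` and does not occur at the other
end `v`, then it serves both the closed and the open neighbourhood of `e`. -/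
theorem hasUniqueColour_of_ends {c : G.edgeSet → C} {e f : G.edgeSet} {u v : V} (huv : u ≠ v)
    (hu : u ∈ (e : Sym2 V)) (hv : v ∈ (e : Sym2 V)) (hf : u ∈ (f : Sym2 V))
    (hcu : ∀ g : G.edgeSet, u ∈ (g : Sym2 V) → c g = c f → g = f)
    (hcv : ∀ g : G.edgeSet, v ∈ (g : Sym2 V) → c g ≠ c f) :
    HasUniqueColour c (closedNbhd e) ∧ HasUniqueColour c (openNbhd e) := by
  have hfe : f ≠ e := by rintro rfl; exact hcv _ hv rfl
  have huniq : ∀ g ∈ closedNbhd e, c g = c f → g = f := by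
    rintro g ⟨w, hw, hwg⟩ hg
    by_cases hug : u ∈ (g : Sym2 V)
    · exact hcu g hug hg
    · have hwv : w = v := by
        obtain ⟨a, b, -, hab⟩ := exists_ends e
        have hwu : w ≠ u := fun h => hug (h ▸ hwg)
        have h1 := (hab u).1 hu
        have h2 := (hab v).1 hv
        have h3 := (hab w).1 hw
        grind
      exact absurd hg (hcv g (hwv ▸ hwg))
  exact ⟨hasUniqueColour_of_closed ⟨u, hu, hf⟩ huniq,
    hasUniqueColour_of_open ⟨⟨u, hu, hf⟩, hfe⟩ fun g hg => huniq g hg.1⟩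

theorem closedIndex_le_card [Fintype C] {c : G.edgeSet → C} (hc : IsClosedConflictFree c) :
    closedIndex G ≤ Fintype.card C := by
  refine Nat.sInf_le ⟨fun e => Fintype.equivFin C (c e), fun e => ?_⟩
  obtain ⟨α, f, hf, hu⟩ := hc e
  exact ⟨Fintype.equivFin C α, f, ⟨hf.1, congrArg _ hf.2⟩,
    fun g hg => hu g ⟨hg.1, (Fintype.equivFin C).injective hg.2⟩⟩

theorem openIndex_le_card [Fintype C] {c : G.edgeSet → C} (hc : IsOpenConflictFree c) :
    openIndex G ≤ Fintype.card C := by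
  refine Nat.sInf_le ⟨fun e => Fintype.equivFin C (c e), fun e he => ?_⟩
  obtain ⟨α, f, hf, hu⟩ := hc e he
  exact ⟨Fintype.equivFin C α, f, ⟨hf.1, congrArg _ hf.2⟩,
    fun g hg => hu g ⟨hg.1, (Fintype.equivFin C).injective hg.2⟩⟩

open Classical in
/-- The colours of the final colouring: `inl (a, b)` for the edges of the sparse subgraph `P`
(strong colour `a`, coin `b` telling membership in `P'`), `inr (inl a)` for the
other edges (the colour `a` of `p` on `K`, and the default `a = none` off `K`), and `inr (inr ())` for the set `Q` of special edges. -/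
noncomputable def combine {N k : ℕ} (P P' Q K : Finset G.edgeSet) (σ : G.edgeSet → Fin N)
    (p : G.edgeSet → Option (Fin k)) (e : G.edgeSet) :
    (Fin N × Bool) ⊕ (Option (Fin k) ⊕ Unit) :=
  if e ∈ P then .inl (σ e, decide (e ∈ P'))
  else if e ∈ Q then .inr (.inr ()) else if e ∈ K then .inr (.inl (p e)) else .inr (.inl none)

section Combine

variable {N k : ℕ} {P P' Q K : Finset G.edgeSet} {σ : G.edgeSet → Fin N}
  {p : G.edgeSet → Option (Fin k)} {e : G.edgeSet}

open Classical in
theorem combine_of_mem (he : e ∈ P) :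
    combine P P' Q K σ p e = .inl (σ e, decide (e ∈ P')) := if_pos he

theorem mem_of_combine_eq_inl {a : Fin N × Bool} (h : combine P P' Q K σ p e = .inl a) :
    e ∈ P := by
  unfold combine at h
  split_ifs at h with he
  exact he

theorem combine_eq_special_iff (hPQ : Disjoint P Q) :
    combine P P' Q K σ p e = .inr (.inr ()) ↔ e ∈ Q := by
  constructor
  · intro h
    unfold combine at h
    split_ifs at h with h1 h2 h3
    · exact h2
    · simp at h
    · simp at h
  · intro he
    unfold combine
    rw [if_neg (Finset.disjoint_right.1 hPQ he), if_pos he]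

theorem combine_of_mem_kept (hPK : Disjoint P K) (hQK : Disjoint Q K) (he : e ∈ K) :
    combine P P' Q K σ p e = .inr (.inl (p e)) := by
  unfold combine
  rw [if_neg (Finset.disjoint_right.1 hPK he), if_neg (Finset.disjoint_right.1 hQK he), if_pos he]

theorem mem_of_combine_eq_some {α : Fin k}
    (h : combine P P' Q K σ p e = .inr (.inl (some α))) : e ∈ K ∧ p e = some α := by
  unfold combine at h
  split_ifs at h with h1 h2 h3
  · simp at h
  · exact ⟨h3, by simpa using h⟩
  · simp at h

end Combine

/-- One colouring that is conflict-free for closed and open neighbourhoods alike. The edges of the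
sparse subgraph `P` have rainbow neighbourhoods in `P`, the edges of `F` outside `P` are served by
the coins on `P`, and the remaining edges by the coins on `F`. The special edges `Q` serve the open
neighbourhoods of the isolated edges of `P`; they are served by `P` itself, since their ends have
degrees `1` and `s` in `P`. -/
theorem exists_conflictFree [Fintype V] [DecidableRel G.Adj] {k s : ℕ} (hs : 2 ≤ s) (hk : 1 ≤ k)
    (hΔ : 8 * G.maxDegree * k ≤ 2 ^ k) (hks : 8 * k * s ≤ 2 ^ s) :
    ∃ c : G.edgeSet → (Fin (4 * s ^ 2 + 1) × Bool) ⊕ (Option (Fin k) ⊕ Unit),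
      IsClosedConflictFree c ∧ IsOpenConflictFree c := by
  classical
  obtain ⟨P, hPs, hPmax⟩ := exists_maximal_bounded G s
  obtain ⟨σ, hσ⟩ := exists_strong_colouring hPs
  -- `g e` is an edge adjacent to `e`, made special when `e` is an isolated edge of `P`
  obtain ⟨g, hg⟩ : ∃ g : G.edgeSet → G.edgeSet, ∀ e, (openNbhd e).Nonempty → g e ∈ openNbhd e := by
    refine ⟨fun e => if h : (openNbhd e).Nonempty then h.choose else e, fun e he => ?_⟩
    simp only [he, dif_pos]
    exact he.choose_spec
  set Iso : Finset G.edgeSet :=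
    {e ∈ P | (∀ f ∈ P, f ∈ closedNbhd e → f = e) ∧ (openNbhd e).Nonempty} with hIso
  have hIso_star : ∀ e ∈ Iso, ∀ v ∈ (e : Sym2 V), star P v = {e} := by
    intro e he v hv
    obtain ⟨heP, hiso, -⟩ := Finset.mem_filter.1 he
    ext f
    rw [mem_star, Finset.mem_singleton]
    constructor
    · exact fun h => hiso f h.1 ⟨v, hv, h.2⟩
    · rintro rfl; exact ⟨heP, hv⟩
  set Q : Finset G.edgeSet := Iso.image g with hQ
  have hQP : ∀ e ∈ Iso, g e ∉ P := by
    intro e he hgP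
    obtain ⟨heP, hiso, hne⟩ := Finset.mem_filter.1 he
    exact (hg e hne).2 (hiso _ hgP (hg e hne).1)
  -- the end of `g e` outside the isolated edge `e` has full degree in `P`
  have hQends : ∀ e ∈ Iso, ∃ u w, u ≠ w ∧ u ∈ (e : Sym2 V) ∧ u ∈ (g e : Sym2 V) ∧
      w ∈ (g e : Sym2 V) ∧ (∀ x ∈ (g e : Sym2 V), x = u ∨ x = w) ∧ (star P w).card = s := by
    intro e he
    obtain ⟨heP, hiso, hne⟩ := Finset.mem_filter.1 he
    obtain ⟨⟨u, hue, hug⟩, -⟩ := hg e hne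
    obtain ⟨w, hw, hws⟩ := hPmax (g e) (hQP e he)
    have huw : u ≠ w := by
      rintro rfl
      rw [hIso_star e he u hue, Finset.card_singleton] at hws
      omega
    refine ⟨u, w, huw, hue, hug, hw, ?_, hws⟩
    obtain ⟨a, b, -, hab⟩ := exists_ends (g e)
    intro x hx
    have h1 := (hab u).1 hug
    have h2 := (hab w).1 hw
    have h3 := (hab x).1 hx
    grind
  obtain ⟨p, hpX, hpp, hpmax⟩ := exists_maximal_partial_colouring (P ∪ Q) k
  set F : Finset G.edgeSet := {e | p e ≠ none} with hF
  have hFP : Disjoint P F := by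
    rw [Finset.disjoint_left]
    intro e heP heF
    exact (Finset.mem_filter.1 heF).2 (hpX e (Finset.mem_union_left _ heP))
  have hpF : ∀ v, Set.InjOn p (star F v) := by
    intro v e he f hf h
    obtain ⟨heF, hv⟩ := mem_star.1 he
    exact hpp e f ⟨v, hv, (mem_star.1 hf).2⟩ h (Finset.mem_filter.1 heF).2
  have hFk : ∀ v, (star F v).card ≤ k := by
    intro v
    have h1 : ((star F v).image p).card ≤ ((Finset.univ : Finset (Fin k)).image some).card := by
      refine Finset.card_le_card fun a ha => ?_
      obtain ⟨e, he, rfl⟩ := Finset.mem_image.1 ha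
      obtain ⟨α, hα⟩ := Option.ne_none_iff_exists'.1 (Finset.mem_filter.1 (mem_star.1 he).1).2
      exact Finset.mem_image.2 ⟨α, Finset.mem_univ _, hα.symm⟩
    rw [Finset.card_image_of_injOn (hpF v)] at h1
    refine h1.trans (Finset.card_image_le.trans ?_)
    simp
  have hσP : ∀ v, Set.InjOn σ (star P v) := by
    intro v e he f hf h
    obtain ⟨heP, hve⟩ := mem_star.1 he
    obtain ⟨hfP, hvf⟩ := mem_star.1 hf
    exact hσ e heP e heP f hfP ⟨v, hve, hve⟩ ⟨v, hve, hvf⟩ h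
  obtain ⟨P', hP'P, hP'⟩ := exists_split hσP hFP (by omega : 1 ≤ s) hFk hks (by
    intro e he
    obtain ⟨v, hv, hvs⟩ := hPmax e (Finset.disjoint_right.1 hFP he)
    refine hvs.symm.trans_le ((Finset.card_image_of_injOn (hσP v)).symm.trans_le ?_)
    refine Finset.card_le_card (Finset.image_subset_image fun f hf => ?_)
    obtain ⟨hfP, hvf⟩ := mem_star.1 hf
    exact Finset.mem_filter.2 ⟨hfP, v, hv, hvf⟩)
  set T : Finset G.edgeSet := {e | e ∉ P ∪ Q ∧ p e = none} with hT
  obtain ⟨K, hKF, hK⟩ := exists_split (T := T) hpF (by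
      rw [Finset.disjoint_left]
      exact fun e he he' => (Finset.mem_filter.1 he).2 (Finset.mem_filter.1 he').2.2) hk
    (D := G.maxDegree) (by
      intro v
      refine le_trans ?_ (G.degree_le_maxDegree v)
      rw [← SimpleGraph.card_incidenceFinset_eq_degree]
      refine Finset.card_le_card_of_injOn Subtype.val ?_ Subtype.val_injective.injOn
      intro e he
      simpa [SimpleGraph.incidenceSet] using (mem_star.1 he).2) hΔ (by
      intro e he
      obtain ⟨-, heX, hep⟩ := Finset.mem_filter.1 he
      calc k = ((Finset.univ : Finset (Fin k)).image some).card := by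
            rw [Finset.card_image_of_injective _ (Option.some_injective _)]; simp
        _ ≤ _ := by
          refine Finset.card_le_card fun a ha => ?_
          obtain ⟨α, -, rfl⟩ := Finset.mem_image.1 ha
          obtain ⟨f, hf, hfα⟩ := hpmax e heX hep α
          exact Finset.mem_image.2 ⟨f, Finset.mem_filter.2
            ⟨Finset.mem_filter.2 ⟨Finset.mem_univ _, by simp [hfα]⟩, hf⟩, hfα⟩)
  have hKP : Disjoint P K := Finset.disjoint_of_subset_right hKF hFP
  have hKQ : Disjoint Q K := Finset.disjoint_left.2 fun e heQ he =>
    (Finset.mem_filter.1 (hKF he)).2 (hpX e (Finset.mem_union_right _ heQ))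
  have hPQ : Disjoint P Q := Finset.disjoint_left.2 fun e heP he => by
    obtain ⟨e', he', rfl⟩ := Finset.mem_image.1 he
    exact hQP e' he' heP
  have hcP : ∀ e ∈ P, combine P P' Q K σ p e = .inl (σ e, decide (e ∈ P')) :=
    fun e he => combine_of_mem he
  have hcP' : ∀ e a, combine P P' Q K σ p e = .inl a → e ∈ P := fun e a => mem_of_combine_eq_inl
  have hcQ : ∀ e, combine P P' Q K σ p e = .inr (.inr ()) ↔ e ∈ Q :=
    fun e => combine_eq_special_iff hPQ
  have hcK : ∀ e ∈ K, combine P P' Q K σ p e = .inr (.inl (p e)) :=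
    fun e he => combine_of_mem_kept hKP hKQ he
  have hcK' : ∀ e α, combine P P' Q K σ p e = .inr (.inl (some α)) → e ∈ K ∧ p e = some α :=
    fun e α => mem_of_combine_eq_some
  generalize combine P P' Q K σ p = c at hcP hcP' hcQ hcK hcK'
  -- an edge is served as soon as the strong colour sets at its ends differ
  have hends : ∀ e : G.edgeSet, ∀ u ∈ (e : Sym2 V), ∀ v ∈ (e : Sym2 V), u ≠ v →
      ∀ α, α ∈ (star P u).image σ → α ∉ (star P v).image σ →
      HasUniqueColour c (closedNbhd e) ∧ HasUniqueColour c (openNbhd e) := by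
    intro e u hu v hv huv α hα hα'
    obtain ⟨f, hf, rfl⟩ := Finset.mem_image.1 hα
    obtain ⟨hfP, huf⟩ := mem_star.1 hf
    refine hasUniqueColour_of_ends huv hu hv huf (fun h hh hcol => ?_) fun h hh hcol => ?_
    all_goals
      rw [hcP f hfP] at hcol
      have hhP := hcP' _ _ hcol
      rw [hcP h hhP] at hcol
      simp only [Sum.inl.injEq, Prod.mk.injEq] at hcol
    · exact hσP u (mem_star.2 ⟨hhP, hh⟩) hf hcol.1
    · exact hα' (Finset.mem_image.2 ⟨h, mem_star.2 ⟨hhP, hh⟩, hcol.1⟩)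
  have hPQFT : ∀ e, e ∈ P ∨ e ∈ Q ∨ e ∈ F ∨ e ∈ T := by
    intro e
    simp only [hF, hT, Finset.mem_filter, Finset.mem_univ, true_and, Finset.mem_union]
    tauto
  have hcP_rainbow : ∀ e ∈ P, ∀ f ∈ P, f ∈ closedNbhd e → ∀ h ∈ closedNbhd e, c h = c f → h = f := by
    intro e he f hf hfe h hh hcol
    rw [hcP f hf] at hcol
    have hhP := hcP' _ _ hcol
    rw [hcP h hhP] at hcol
    simp only [Sum.inl.injEq, Prod.mk.injEq] at hcol
    exact hσ e he h hhP f hf hh hfe hcol.1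
  have hout : ∀ e, e ∉ P → HasUniqueColour c (closedNbhd e) ∧ HasUniqueColour c (openNbhd e) := by
    intro e he
    rcases (hPQFT e).resolve_left he with heQ | heF | heT
    · obtain ⟨e', he', rfl⟩ := Finset.mem_image.1 heQ
      obtain ⟨u, w, huw, hue, hug, hwg, -, hws⟩ := hQends e' he'
      -- `w` sees at least two strong colours and `u` only one
      have hlt : ((star P u).image σ).card < ((star P w).image σ).card := by
        rw [Finset.card_image_of_injOn (hσP w), hws, hIso_star e' he' u hue]
        simp only [Finset.image_singleton, Finset.card_singleton]
        omega
      obtain ⟨α, h1, h2⟩ := Finset.exists_mem_notMem_of_card_lt_card hlt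
      exact hends _ w hwg u hug huw.symm α h1 h2
    · obtain ⟨u, hu, v, hv, huv, α, h1, h2⟩ := hP' e heF
      obtain ⟨f, hf, rfl⟩ := Finset.mem_image.1 h1
      obtain ⟨hfP', huf⟩ := mem_star.1 hf
      have hfP := hP'P hfP'
      refine hasUniqueColour_of_ends huv hu hv huf (fun h hh hcol => ?_) fun h hh hcol => ?_
      all_goals
        rw [hcP f hfP] at hcol
        have hhP := hcP' _ _ hcol
        rw [hcP h hhP] at hcol
        simp only [Sum.inl.injEq, Prod.mk.injEq, hfP', decide_eq_decide, iff_true] at hcol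
      · exact hσP u (mem_star.2 ⟨hhP, hh⟩) (mem_star.2 ⟨hfP, huf⟩) hcol.1
      · exact h2 (Finset.mem_image.2 ⟨h, mem_star.2 ⟨hcol.2, hh⟩, hcol.1⟩)
    · obtain ⟨u, hu, v, hv, huv, a, h1, h2⟩ := hK e heT
      obtain ⟨f, hf, rfl⟩ := Finset.mem_image.1 h1
      obtain ⟨hfK, huf⟩ := mem_star.1 hf
      obtain ⟨α, hα⟩ := Option.ne_none_iff_exists'.1 (Finset.mem_filter.1 (hKF hfK)).2
      refine hasUniqueColour_of_ends huv hu hv huf (fun h hh hcol => ?_) fun h hh hcol => ?_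
      all_goals
        rw [hcK f hfK, hα] at hcol
        obtain ⟨hhK, hhα⟩ := hcK' _ _ hcol
      · exact hpF u (mem_star.2 ⟨hKF hhK, hh⟩) (mem_star.2 ⟨hKF hfK, huf⟩) (hhα.trans hα.symm)
      · exact h2 (Finset.mem_image.2 ⟨h, mem_star.2 ⟨hhK, hh⟩, hhα.trans hα.symm⟩)
  refine ⟨c, fun e => ?_, fun e hne => ?_⟩
  · by_cases he : e ∈ P
    · exact hasUniqueColour_of_closed (mem_closedNbhd_self e)
        (hcP_rainbow e he e he (mem_closedNbhd_self e))
    · exact (hout e he).1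
  · by_cases he : e ∈ P
    swap
    · exact (hout e he).2
    by_cases hiso : ∃ f ∈ P, f ∈ openNbhd e
    · obtain ⟨f, hf, hfe⟩ := hiso
      exact hasUniqueColour_of_open hfe fun h hh => hcP_rainbow e he f hf hfe.1 h hh.1
    -- `e` is isolated in `P`, and `g e` is the only special edge adjacent to `e`
    · push Not at hiso
      have heI : e ∈ Iso := Finset.mem_filter.2 ⟨he, fun f hf hfe => by
        by_contra hne
        exact hiso f hf ⟨hfe, hne⟩, hne⟩
      refine hasUniqueColour_of_open (hg e hne) fun h hh hcol => ?_
      rw [(hcQ (g e)).2 (Finset.mem_image_of_mem g heI), hcQ] at hcol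
      obtain ⟨e', he', rfl⟩ := Finset.mem_image.1 hcol
      obtain ⟨u, w, huw, hue, -, -, hux, hws⟩ := hQends e' he'
      obtain ⟨⟨x, hxe, hxg⟩, -⟩ := hh
      have hx := hIso_star e heI x hxe
      rcases hux x hxg with rfl | rfl
      · rw [hIso_star e' he' x hue, Finset.singleton_inj] at hx
        rw [hx]
      · rw [hx, Finset.card_singleton] at hws
        omega

theorem index_le [Fintype V] [DecidableRel G.Adj] {k s : ℕ} (hs : 2 ≤ s) (hk : 1 ≤ k)
    (hΔ : 8 * G.maxDegree * k ≤ 2 ^ k) (hks : 8 * k * s ≤ 2 ^ s) :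
    closedIndex G ≤ k + 8 * s ^ 2 + 4 ∧ openIndex G ≤ k + 8 * s ^ 2 + 4 := by
  obtain ⟨c, h1, h2⟩ := exists_conflictFree hs hk hΔ hks
  have hcard : Fintype.card ((Fin (4 * s ^ 2 + 1) × Bool) ⊕ (Option (Fin k) ⊕ Unit)) =
      k + 8 * s ^ 2 + 4 := by
    simp
    ring
  exact ⟨hcard ▸ closedIndex_le_card h1, hcard ▸ openIndex_le_card h2⟩

end Upper

/-! ### The lower bound for complete graphs -/

section Lower

variable {n : ℕ} {C : Type*}

/-- The edge `uv` of the complete graph. -/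
def topEdge {u v : Fin n} (h : u ≠ v) : (⊤ : SimpleGraph (Fin n)).edgeSet := ⟨s(u, v), h⟩

/-- The colour of `e` occurs exactly once at `v`, namely on `e`. -/
def IsSoleAt (c : (⊤ : SimpleGraph (Fin n)).edgeSet → C) (v : Fin n)
    (e : (⊤ : SimpleGraph (Fin n)).edgeSet) : Prop :=
  v ∈ (e : Sym2 (Fin n)) ∧ ∀ f : (⊤ : SimpleGraph (Fin n)).edgeSet,
    v ∈ (f : Sym2 (Fin n)) → c f = c e → f = e

open Classical in
/-- The set of colours that occur exactly once at `v`. -/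
noncomputable def soleColours [Fintype C] (c : (⊤ : SimpleGraph (Fin n)).edgeSet → C) (v : Fin n) :
    Finset C :=
  {α | ∃ e, IsSoleAt c v e ∧ c e = α}

theorem mem_soleColours [Fintype C] {c : (⊤ : SimpleGraph (Fin n)).edgeSet → C} {v : Fin n}
    {α : C} : α ∈ soleColours c v ↔ ∃ e, IsSoleAt c v e ∧ c e = α := by
  simp [soleColours]

theorem mem_topEdge {u v w : Fin n} (h : u ≠ v) :
    w ∈ (topEdge h : Sym2 (Fin n)) ↔ w = u ∨ w = v := Sym2.mem_iff

/-- Let `u` and `v` have the same sole colours, and let the colour of an edge `f ≠ uv` at `u` be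
unique in `E(uv)`. If `f` and `uv` had different colours, that of `f` would be a sole colour of `u`
missing at `v`; so they agree, and `uv` is the only edge of this colour at `v`. -/
theorem isSoleAt_of_unique [Fintype C] {c : (⊤ : SimpleGraph (Fin n)).edgeSet → C} {u v : Fin n}
    (huv : u ≠ v) (huniq : soleColours c u = soleColours c v)
    {f : (⊤ : SimpleGraph (Fin n)).edgeSet} (hfe : f ≠ topEdge huv) (huf : u ∈ (f : Sym2 (Fin n)))
    (hf : ∀ g ∈ openNbhd (topEdge huv), c g = c f → g = f) : IsSoleAt c v (topEdge huv) := by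
  have hvf : v ∉ (f : Sym2 (Fin n)) := fun hvf =>
    hfe (edge_eq_of_mem huv huf hvf ((mem_topEdge huv).2 (Or.inl rfl))
      ((mem_topEdge huv).2 (Or.inr rfl)))
  have hv : ∀ g : (⊤ : SimpleGraph (Fin n)).edgeSet, v ∈ (g : Sym2 (Fin n)) → c g = c f →
      g = topEdge huv := by
    intro g hvg hgf
    by_contra hg
    have := hf g ⟨⟨v, (mem_topEdge huv).2 (Or.inr rfl), hvg⟩, hg⟩ hgf
    exact hvf (this ▸ hvg)
  have hcf : c (topEdge huv) = c f := by
    by_contra hcf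
    have h1 : IsSoleAt c u f := by
      refine ⟨huf, fun g hug hgf => hf g ⟨⟨u, (mem_topEdge huv).2 (Or.inl rfl), hug⟩, ?_⟩ hgf⟩
      rintro rfl
      exact hcf hgf
    have h2 : c f ∈ soleColours c v := huniq ▸ mem_soleColours.2 ⟨f, h1, rfl⟩
    obtain ⟨g, hg, hgf⟩ := mem_soleColours.1 h2
    exact hcf (hv g hg.1 hgf ▸ hgf)
  exact ⟨(mem_topEdge huv).2 (Or.inr rfl), fun g hvg hg => hv g hvg (hg.trans hcf)⟩

theorem topEdge_comm {u v : Fin n} (h : u ≠ v) : topEdge h = topEdge h.symm :=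
  Subtype.ext Sym2.eq_swap

theorem isSoleAt_or_of_open [Fintype C] {c : (⊤ : SimpleGraph (Fin n)).edgeSet → C} {u v : Fin n}
    (huv : u ≠ v) (huniq : soleColours c u = soleColours c v)
    (hc : HasUniqueColour c (openNbhd (topEdge huv))) :
    IsSoleAt c u (topEdge huv) ∨ IsSoleAt c v (topEdge huv) := by
  obtain ⟨_, f, ⟨⟨⟨w, hw, hwf⟩, hfe⟩, rfl⟩, hf⟩ := hc
  rcases (mem_topEdge huv).1 hw with rfl | rfl
  · exact Or.inr (isSoleAt_of_unique huv huniq hfe hwf fun g hg h => hf g ⟨hg, h⟩)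
  · rw [topEdge_comm huv] at hfe hf ⊢
    exact Or.inl (isSoleAt_of_unique huv.symm huniq.symm hfe hwf fun g hg h => hf g ⟨hg, h⟩)

theorem isSoleAt_or_of_closed [Fintype C] {c : (⊤ : SimpleGraph (Fin n)).edgeSet → C}
    {u v : Fin n} (huv : u ≠ v) (huniq : soleColours c u = soleColours c v)
    (hc : HasUniqueColour c (closedNbhd (topEdge huv))) :
    IsSoleAt c u (topEdge huv) ∨ IsSoleAt c v (topEdge huv) := by
  obtain ⟨α, f, ⟨hfc, hα⟩, hf⟩ := hc
  by_cases hfe : f = topEdge huv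
  · subst hfe
    have hu := (mem_topEdge huv).2 (Or.inl rfl : u = u ∨ u = v)
    exact Or.inl ⟨hu, fun g hg h => hf g ⟨⟨u, hu, hg⟩, h.trans hα⟩⟩
  · exact isSoleAt_or_of_open huv huniq ⟨α, f, ⟨⟨hfc, hfe⟩, hα⟩, fun g hg => hf g ⟨hg.1.1, hg.2⟩⟩

/-- If vertices with the same sole colours are always joined by an edge that is the sole one of its
colour at one of its ends, then such a class has at most `2 k + 1` vertices, because each vertex has
at most `k` sole edges; and there are at most `2 ^ k` classes. -/
theorem le_of_isSoleAt_or {k : ℕ} {c : (⊤ : SimpleGraph (Fin n)).edgeSet → Fin k}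
    (hc : ∀ u v : Fin n, ∀ huv : u ≠ v, soleColours c u = soleColours c v →
      IsSoleAt c u (topEdge huv) ∨ IsSoleAt c v (topEdge huv)) : n ≤ 2 ^ k * (2 * k + 1) := by
  classical
  have hfib : ∀ A : Finset (Fin k),
      ({v | soleColours c v = A} : Finset (Fin n)).card ≤ 2 * k + 1 := by
    intro A
    set W : Finset (Fin n) := {v | soleColours c v = A} with hW
    -- the ordered pairs `(u, v)` such that `uv` is the sole edge of its colour at `u`
    set O : Finset (Fin n × Fin n) :=
      {x ∈ W ×ˢ W | ∃ h : x.1 ≠ x.2, IsSoleAt c x.1 (topEdge h)} with hO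
    have hOcard : O.card ≤ W.card * k := by
      refine (Finset.card_le_mul_card_image_of_maps_to (f := Prod.fst) (t := W)
        (fun x hx => (Finset.mem_product.1 (Finset.mem_filter.1 hx).1).1) k
        (fun u _ => ?_)).trans_eq (mul_comm _ _)
      have hex : ∀ x : Fin n × Fin n, ∃ α, ∀ h : x.1 ≠ x.2, x ∈ O → α = some (c (topEdge h)) := by
        intro x
        by_cases h : x.1 ≠ x.2
        · exact ⟨some (c (topEdge h)), fun _ _ => rfl⟩
        · exact ⟨none, fun h' => absurd h' h⟩
      choose φ hφ using hex
      have hle : ({x ∈ O | x.1 = u} : Finset _).card ≤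
          ((Finset.univ : Finset (Fin k)).image some).card := by
        refine Finset.card_le_card_of_injOn φ ?_ ?_
        · intro x hx
          have hxO := (Finset.mem_filter.1 hx).1
          obtain ⟨-, h, -⟩ := Finset.mem_filter.1 hxO
          simp [hφ x h hxO]
        · rintro ⟨u₁, v⟩ hx ⟨u₂, w⟩ hy hxy
          obtain ⟨hxO, rfl⟩ := Finset.mem_filter.1 hx
          obtain ⟨hyO, rfl⟩ := Finset.mem_filter.1 hy
          obtain ⟨-, h, hs⟩ := Finset.mem_filter.1 hxO
          obtain ⟨-, h', hs'⟩ := Finset.mem_filter.1 hyO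
          rw [hφ _ h hxO, hφ _ h' hyO, Option.some.injEq] at hxy
          have := congrArg Subtype.val (hs'.2 _ hs.1 hxy)
          rcases Sym2.eq_iff.1 this with h₁ | h₁
          · exact Prod.ext rfl h₁.2
          · exact absurd h₁.2.symm h
      simpa [Finset.card_image_of_injective _ (Option.some_injective _)] using hle
    have hoff : W.offDiag ⊆ O ∪ O.image Prod.swap := by
      intro x hx
      obtain ⟨h1, h2, h3⟩ := Finset.mem_offDiag.1 hx
      have h1' := (Finset.mem_filter.1 h1).2
      have h2' := (Finset.mem_filter.1 h2).2
      rcases hc x.1 x.2 h3 (h1'.trans h2'.symm) with h | h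
      · exact Finset.mem_union_left _ (Finset.mem_filter.2
          ⟨Finset.mem_product.2 ⟨h1, h2⟩, h3, h⟩)
      · refine Finset.mem_union_right _ (Finset.mem_image.2 ⟨x.swap, Finset.mem_filter.2
          ⟨Finset.mem_product.2 ⟨h2, h1⟩, h3.symm, ?_⟩, rfl⟩)
        exact topEdge_comm h3 ▸ h
    have h1 := (Finset.card_le_card hoff).trans (Finset.card_union_le _ _)
    have h2 := Finset.card_image_le (s := O) (f := Prod.swap)
    rw [Finset.offDiag_card] at h1
    rcases Nat.eq_zero_or_pos W.card with h0 | h0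
    · omega
    · by_contra! hlt
      have h3 : W.card * (2 * k + 1) < W.card * W.card := Nat.mul_lt_mul_of_pos_left hlt h0
      have h4 : W.card * (2 * k + 1) = 2 * (W.card * k) + W.card := by ring
      omega
  have h := Finset.card_le_mul_card_image_of_maps_to (s := (Finset.univ : Finset (Fin n)))
    (f := soleColours c) (t := Finset.univ) (fun _ _ => Finset.mem_univ _) (2 * k + 1)
    (fun A _ => hfib A)
  simpa [mul_comm] using h

end Lower

/-! ### Choice of parameters and asymptotics -/

section Asymptotics

open Filter Topology

/-- The number of colours carrying the main coins when `log₂ Δ` rounds up to `L`. -/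
def mainCount (L : ℕ) : ℕ := L + Nat.clog 2 L + 6

/-- The degree bound of the sparse subgraph when `log₂ Δ` rounds up to `L`. -/
def sparseDegree (L : ℕ) : ℕ := 2 * Nat.clog 2 (mainCount L) + 8

/-- The number of colours used beyond the leading term `L`. -/
def excess (L : ℕ) : ℕ := Nat.clog 2 L + 8 * sparseDegree L ^ 2 + 10

theorem mainCount_spec (Δ : ℕ) :
    8 * Δ * mainCount (Nat.clog 2 Δ) ≤ 2 ^ mainCount (Nat.clog 2 Δ) := by
  set L := Nat.clog 2 Δ with hL
  have h1 : Δ ≤ 2 ^ L := Nat.le_pow_clog one_lt_two Δ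
  have h2 : L ≤ 2 ^ Nat.clog 2 L := Nat.le_pow_clog one_lt_two L
  have h3 : Nat.clog 2 L < 2 ^ Nat.clog 2 L := Nat.lt_two_pow_self
  have h4 : 8 * mainCount L ≤ 2 ^ (Nat.clog 2 L + 6) := by
    rw [pow_add, mainCount]
    omega
  calc 8 * Δ * mainCount L = Δ * (8 * mainCount L) := by ring
    _ ≤ 2 ^ L * 2 ^ (Nat.clog 2 L + 6) := Nat.mul_le_mul h1 h4
    _ = _ := by rw [← pow_add, mainCount, add_assoc]

theorem sparseDegree_spec (L : ℕ) :
    8 * mainCount L * sparseDegree L ≤ 2 ^ sparseDegree L := by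
  set m := Nat.clog 2 (mainCount L) with hm
  have h1 : mainCount L ≤ 2 ^ m := Nat.le_pow_clog one_lt_two _
  have h2 : 8 * sparseDegree L ≤ 2 ^ (m + 8) := by
    have : m < 2 ^ m := Nat.lt_two_pow_self
    rw [pow_add, sparseDegree]
    omega
  calc 8 * mainCount L * sparseDegree L = mainCount L * (8 * sparseDegree L) := by ring
    _ ≤ 2 ^ m * 2 ^ (m + 8) := Nat.mul_le_mul h1 h2
    _ = _ := by rw [← pow_add, sparseDegree, ← hm]; ring_nf

theorem index_le_add_excess {V : Type*} [Fintype V] (G : SimpleGraph V) [DecidableRel G.Adj] :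
    closedIndex G ≤ Nat.clog 2 G.maxDegree + excess (Nat.clog 2 G.maxDegree) ∧
      openIndex G ≤ Nat.clog 2 G.maxDegree + excess (Nat.clog 2 G.maxDegree) := by
  have h := index_le (G := G) (k := mainCount (Nat.clog 2 G.maxDegree))
    (s := sparseDegree (Nat.clog 2 G.maxDegree)) (by unfold sparseDegree; omega)
    (by unfold mainCount; omega) (mainCount_spec _) (sparseDegree_spec _)
  have he : ∀ L, mainCount L + 8 * sparseDegree L ^ 2 + 4 = L + excess L := fun L => by
    unfold mainCount excess; ring
  rwa [he] at h

theorem sparseDegree_le {L : ℕ} (hL : 1 ≤ L) : sparseDegree L ≤ 2 * Nat.clog 2 L + 14 := by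
  have h1 : L ≤ 2 ^ Nat.clog 2 L := Nat.le_pow_clog one_lt_two L
  have h2 : Nat.clog 2 L ≤ L := Nat.clog_le_of_le_pow Nat.lt_two_pow_self.le
  have h3 : Nat.clog 2 (mainCount L) ≤ Nat.clog 2 L + 3 := by
    refine Nat.clog_le_of_le_pow ?_
    rw [pow_add, mainCount]
    omega
  unfold sparseDegree
  omega

theorem clog_le_log {L : ℕ} (hL : 1 ≤ L) :
    (Nat.clog 2 L : ℝ) ≤ (Real.log 2)⁻¹ * Real.log L + 1 := by
  have h := Real.natCeil_logb_natCast 2 L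
  have h0 : 0 ≤ Real.logb (2 : ℕ) L :=
    Real.logb_nonneg (by norm_num) (by exact_mod_cast hL)
  rw [← h]
  refine (Nat.ceil_lt_add_one h0).le.trans_eq ?_
  rw [Real.logb, div_eq_inv_mul]
  norm_num

theorem tendsto_excess_div : Tendsto (fun L : ℕ => (excess L : ℝ) / L) atTop (𝓝 0) := by
  -- `excess L` is at most a quadratic polynomial in `log L`
  set a := (Real.log 2)⁻¹ with ha
  have hpow : ∀ j : ℕ, Tendsto (fun L : ℕ => Real.log L ^ j / (L : ℝ)) atTop (𝓝 0) := fun j =>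
    (Real.isLittleO_pow_log_id_atTop (n := j)).tendsto_div_nhds_zero.comp
      tendsto_natCast_atTop_atTop
  have hlim := (((hpow 2).const_mul (32 * a ^ 2)).add ((hpow 1).const_mul (513 * a))).add
    ((hpow 0).const_mul 2059)
  simp only [mul_zero, add_zero] at hlim
  refine squeeze_zero' (Eventually.of_forall fun L => by positivity) ?_ hlim
  filter_upwards [eventually_ge_atTop 1] with L hL
  have h1 := clog_le_log hL
  rw [← ha] at h1
  have h2 : (sparseDegree L : ℝ) ≤ 2 * (Nat.clog 2 L : ℝ) + 14 := by
    exact_mod_cast sparseDegree_le hL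
  have h3 : (sparseDegree L : ℝ) ≤ 2 * (a * Real.log L) + 16 := by linarith
  have h4 : (sparseDegree L : ℝ) ^ 2 ≤ (2 * (a * Real.log L) + 16) ^ 2 := by gcongr
  have h5 : (excess L : ℝ) ≤ 32 * a ^ 2 * Real.log L ^ 2 + 513 * a * Real.log L + 2059 := by
    unfold excess
    push_cast
    linarith
  have h6 : (0 : ℝ) < L := by exact_mod_cast hL
  calc (excess L : ℝ) / L ≤ (32 * a ^ 2 * Real.log L ^ 2 + 513 * a * Real.log L + 2059) / L := by
        gcongr
    _ = _ := by ring

theorem tendsto_logb_natCast : Tendsto (fun Δ : ℕ => Real.logb 2 Δ) atTop atTop :=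
  (Real.tendsto_logb_atTop one_lt_two).comp tendsto_natCast_atTop_atTop

theorem tendsto_upper : Tendsto (fun Δ : ℕ =>
    ((Nat.clog 2 Δ + excess (Nat.clog 2 Δ) : ℕ) : ℝ) / Real.logb 2 Δ - 1) atTop (𝓝 0) := by
  have hcl : ∀ Δ : ℕ, ((⌈Real.logb 2 Δ⌉₊ : ℕ) : ℝ) = Nat.clog 2 Δ := fun Δ => by
    exact_mod_cast Real.natCeil_logb_natCast 2 Δ
  have h1 : Tendsto (fun Δ : ℕ => (Nat.clog 2 Δ : ℝ) / Real.logb 2 Δ) atTop (𝓝 1) := by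
    have := (tendsto_nat_ceil_div_atTop (R := ℝ)).comp tendsto_logb_natCast
    simpa only [Function.comp_def, hcl] using this
  have h2 : Tendsto (fun Δ : ℕ => Nat.clog 2 Δ) atTop atTop := by
    have := tendsto_nat_ceil_atTop.comp tendsto_logb_natCast
    exact this.congr fun Δ => Nat.cast_injective (R := ℝ) (hcl Δ)
  have h3 := (h1.mul ((tendsto_excess_div.comp h2).const_add 1)).sub_const 1
  simp only [add_zero, mul_one, sub_self] at h3
  refine h3.congr' ?_
  filter_upwards [h2.eventually_ge_atTop 1] with Δ hΔ
  have h4 : (0 : ℝ) < Nat.clog 2 Δ := by exact_mod_cast hΔ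
  simp only [Function.comp_apply]
  push_cast
  field_simp

theorem tendsto_lower : Tendsto (fun Δ : ℕ =>
    Real.logb 2 (2 * Real.logb 2 Δ + 1) / Real.logb 2 Δ) atTop (𝓝 0) := by
  have h : Tendsto (fun x : ℝ => Real.logb 2 (2 * x + 1) / x) atTop (𝓝 0) := by
    have h1 : Tendsto (fun x : ℝ => 2 * x + 1) atTop atTop :=
      tendsto_atTop_add_const_right _ _ (tendsto_id.const_mul_atTop two_pos)
    have h2 := Real.isLittleO_log_id_atTop.tendsto_div_nhds_zero.comp h1
    have h3 := (h2.mul ((tendsto_inv_atTop_zero (𝕜 := ℝ)).const_add 2)).const_mul (Real.log 2)⁻¹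
    simp only [zero_mul, mul_zero] at h3
    refine h3.congr' ?_
    filter_upwards [eventually_gt_atTop 0] with x hx
    have : 2 * x + 1 ≠ 0 := by positivity
    simp only [Function.comp_apply, id_eq, Real.logb]
    field_simp
  exact h.comp tendsto_logb_natCast

/-- If `n ≤ 2 ^ k (2 k + 1)` then `k` is at least `log₂ Δ - log₂ (2 log₂ Δ + 1)` for `Δ = n - 1`:
either `k ≥ log₂ Δ`, or `log₂ (2 k + 1) ≤ log₂ (2 log₂ Δ + 1)`. -/
theorem logb_sub_le_of_le {n k : ℕ} (hn : 3 ≤ n) (h : n ≤ 2 ^ k * (2 * k + 1)) :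
    Real.logb 2 (n - 1 : ℕ) - Real.logb 2 (2 * Real.logb 2 (n - 1 : ℕ) + 1) ≤ k := by
  set x := Real.logb 2 (n - 1 : ℕ) with hx
  have hn1 : (1 : ℝ) ≤ (n - 1 : ℕ) := by exact_mod_cast (by omega : 1 ≤ n - 1)
  have hx0 : 0 ≤ x := Real.logb_nonneg one_lt_two hn1
  have hl0 : 0 ≤ Real.logb 2 (2 * x + 1) := Real.logb_nonneg one_lt_two (by linarith)
  rcases le_or_gt x k with hk | hk
  · linarith
  · have h1 : x ≤ Real.logb 2 (2 ^ k * (2 * k + 1)) := by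
      refine Real.logb_le_logb_of_le one_lt_two (by linarith) ?_
      exact_mod_cast (by omega : n - 1 ≤ 2 ^ k * (2 * k + 1))
    have h2 : Real.logb 2 (2 * k + 1) ≤ Real.logb 2 (2 * x + 1) :=
      Real.logb_le_logb_of_le one_lt_two (by positivity) (by linarith)
    rw [Real.logb_mul (by positivity) (by positivity), Real.logb_pow,
      Real.logb_self_eq_one one_lt_two] at h1
    linarith

end Asymptotics

theorem le_of_closedIndex_top (n : ℕ) :
    n ≤ 2 ^ closedIndex (⊤ : SimpleGraph (Fin n)) *
      (2 * closedIndex (⊤ : SimpleGraph (Fin n)) + 1) := by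
  obtain ⟨c, hc⟩ := Nat.sInf_mem (closed_exists (⊤ : SimpleGraph (Fin n)))
  exact le_of_isSoleAt_or (c := c) fun u v huv h => isSoleAt_or_of_closed huv h (hc _)

theorem openNbhd_topEdge_nonempty {n : ℕ} (hn : 3 ≤ n) {u v : Fin n} (huv : u ≠ v) :
    (openNbhd (topEdge huv)).Nonempty := by
  obtain ⟨w, hw⟩ : ∃ w : Fin n, w ∉ ({u, v} : Finset (Fin n)) := by
    by_contra! h
    have h1 := (Finset.card_le_card fun w (_ : w ∈ Finset.univ) => h w).trans Finset.card_le_two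
    rw [Finset.card_univ, Fintype.card_fin] at h1
    omega
  simp only [Finset.mem_insert, Finset.mem_singleton, not_or] at hw
  refine ⟨topEdge (Ne.symm hw.1), ⟨u, (mem_topEdge _).2 (Or.inl rfl),
    (mem_topEdge _).2 (Or.inl rfl)⟩, fun h => ?_⟩
  have h1 : w ∈ (topEdge huv : Sym2 (Fin n)) :=
    (Set.mem_singleton_iff.1 h) ▸ (mem_topEdge _).2 (Or.inr rfl)
  rcases (mem_topEdge huv).1 h1 with h | h
  · exact hw.1 h
  · exact hw.2 h

theorem le_of_openIndex_top {n : ℕ} (hn : 3 ≤ n) :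
    n ≤ 2 ^ openIndex (⊤ : SimpleGraph (Fin n)) *
      (2 * openIndex (⊤ : SimpleGraph (Fin n)) + 1) := by
  obtain ⟨c, hc⟩ := Nat.sInf_mem (open_exists (⊤ : SimpleGraph (Fin n)))
  exact le_of_isSoleAt_or (c := c) fun u v huv h =>
    isSoleAt_or_of_open huv h (hc _ (openNbhd_topEdge_nonempty hn huv))

end ConflictFree

theorem mainTheorem2 :
    ∃ ε : ℕ → ℝ, Filter.Tendsto ε Filter.atTop (nhds 0) ∧
      (∀ (V : Type*) [Fintype V] (G : SimpleGraph V) [DecidableRel G.Adj],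
        1 < G.maxDegree →
          (ConflictFree.closedIndex G : ℝ) ≤
              (1 + ε G.maxDegree) * Real.logb 2 (G.maxDegree : ℝ) ∧
          (ConflictFree.openIndex G : ℝ) ≤
              (1 + ε G.maxDegree) * Real.logb 2 (G.maxDegree : ℝ)) ∧
      (∀ n : ℕ, 3 ≤ n →
        (1 - ε (⊤ : SimpleGraph (Fin n)).maxDegree) *
              Real.logb 2 ((⊤ : SimpleGraph (Fin n)).maxDegree : ℝ) ≤
            (ConflictFree.closedIndex (⊤ : SimpleGraph (Fin n)) : ℝ) ∧
        (1 - ε (⊤ : SimpleGraph (Fin n)).maxDegree) *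
              Real.logb 2 ((⊤ : SimpleGraph (Fin n)).maxDegree : ℝ) ≤
            (ConflictFree.openIndex (⊤ : SimpleGraph (Fin n)) : ℝ)) := by
  have hpos : ∀ Δ : ℕ, 1 < Δ → 0 < Real.logb 2 Δ := fun Δ hΔ =>
    Real.logb_pos one_lt_two (by exact_mod_cast hΔ)
  refine ⟨fun Δ => max (((Nat.clog 2 Δ + ConflictFree.excess (Nat.clog 2 Δ) : ℕ) : ℝ) /
      Real.logb 2 Δ - 1) (Real.logb 2 (2 * Real.logb 2 Δ + 1) / Real.logb 2 Δ), ?_, ?_, ?_⟩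
  · simpa only [max_self] using ConflictFree.tendsto_upper.max ConflictFree.tendsto_lower
  · intro V _ G _ hΔ
    have key : ((Nat.clog 2 G.maxDegree + ConflictFree.excess (Nat.clog 2 G.maxDegree) : ℕ) : ℝ) ≤
        (1 + max (((Nat.clog 2 G.maxDegree +
          ConflictFree.excess (Nat.clog 2 G.maxDegree) : ℕ) : ℝ) / Real.logb 2 G.maxDegree - 1)
          (Real.logb 2 (2 * Real.logb 2 G.maxDegree + 1) / Real.logb 2 G.maxDegree)) *
          Real.logb 2 G.maxDegree := by
      rw [← div_le_iff₀ (hpos _ hΔ)]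
      linarith [le_max_left (((Nat.clog 2 G.maxDegree +
          ConflictFree.excess (Nat.clog 2 G.maxDegree) : ℕ) : ℝ) / Real.logb 2 G.maxDegree - 1)
          (Real.logb 2 (2 * Real.logb 2 G.maxDegree + 1) / Real.logb 2 G.maxDegree)]
    have h := ConflictFree.index_le_add_excess G
    exact ⟨(Nat.cast_le.2 h.1).trans key, (Nat.cast_le.2 h.2).trans key⟩
  · intro n hn
    have hdeg : (⊤ : SimpleGraph (Fin n)).maxDegree = n - 1 := by
      have : Nonempty (Fin n) := ⟨⟨0, by omega⟩⟩
      simp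
    rw [hdeg]
    have key : ∀ k : ℕ, n ≤ 2 ^ k * (2 * k + 1) →
        (1 - max (((Nat.clog 2 (n - 1) + ConflictFree.excess (Nat.clog 2 (n - 1)) : ℕ) : ℝ) /
          Real.logb 2 (n - 1 : ℕ) - 1)
          (Real.logb 2 (2 * Real.logb 2 (n - 1 : ℕ) + 1) / Real.logb 2 (n - 1 : ℕ))) *
          Real.logb 2 (n - 1 : ℕ) ≤ k := by
      intro k hk
      have hx := hpos (n - 1) (by omega)
      refine le_trans ?_ (ConflictFree.logb_sub_le_of_le hn hk)
      refine (mul_le_mul_of_nonneg_right (sub_le_sub_left (le_max_right _ _) 1) hx.le).trans_eq ?_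
      field_simp
    exact ⟨key _ (ConflictFree.le_of_closedIndex_top n), key _ (ConflictFree.le_of_openIndex_top hn)⟩
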